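/- For a partition of $V_6=\{1,\dots,6\}$ into four nonempty blocks $S_1,\dots,S_4$ let $\alpha(S_1,\dots,S_4)$ be the vector in $\mathbb{R}^{15}$, with coordinates indexed by the $4$-subsets of $V_6$, whose coordinate at $s$ is $1$ if no two elements of $s$ lie in the same block, and $0$ otherwise (a partition $3$-hemimetric; blocks are written without braces, e.g. $\alpha(12,34,5,6)$). Let $P_6^3\subset\mathbb{R}^{15}$ be the convex cone generated by all these vectors. A face of $P_6^3$ is a set $\{x\in P_6^3 : v^Tx=0\}$, where $v^Tx\le 0$ for all $x\in P_6^3$; its dimension is the dimension of its linear span; an extreme ray is a face of dimension $1$. The skeleton of $P_6^3$ is the graph whose nodes are the extreme rays, two distinct extreme rays being adjacent if together they generate a face of dimension $2$. The orbit of an extreme ray is the set of its images under all linear isometries $f$ of $\mathbb{R}^{15}$ with $f(P_6^3)=P_6^3$. Then: $P_6^3$ has dimension $15$; there are exactly $65$ partition $3$-hemimetrics $\alpha(S_1,\dots,S_4)$, and the extreme rays of $P_6^3$ are exactly the $65$ distinct rays generated by them; they form exactly two orbits, the orbit $O_1$ of the ray of $\alpha(1,2,3,456)$ and the orbit $O_2$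 of the ray of $\alpha(1,2,34,56)$. The skeleton of $P_6^3$ has diameter $2$. Moreover: (i) the subgraph of the skeleton induced on $O_1$ is $K_{20}$, and the subgraph induced on $O_2$ is $K_{45}-15K_3$ (the complete graph on $45$ nodes minus the edges of $15$ disjoint triangles); (ii) the ray of $\alpha(12,34,5,6)$ is different from and not adjacent to the rays of $\alpha(12,3,4,56)$, $\alpha(1,2,34,56)$, $\alpha(125,3,4,6)$, $\alpha(126,3,4,5)$, $\alpha(345,1,2,6)$ and $\alpha(346,1,2,5)$; and these pairs represent all non-edges: two distinct extreme rays are non-adjacent if and only if some permutation of $V_6$ maps one of these six pairs to the (unordered) pair of these rays. -/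

import Mathlib

/-! Partition hemimetrics, the cone generated by them, and the 1-skeleton of a cone. -/

namespace Hemimetric

/-! ### Faces, extreme rays, skeleton and symmetries of a cone -/

section Cone

variable {E : Type*} [NormedAddCommGroup E] [InnerProductSpace ℝ E]

/-- `F` is the face of `C` induced by a valid inequality `⟪v, x⟫ ≤ 0`. -/
def IsFace (C : PointedCone ℝ E) (F : Set E) : Prop :=
  ∃ v : E, (∀ x ∈ C, inner ℝ v x ≤ 0) ∧ F = {x : E | x ∈ C ∧ inner ℝ v x = 0}

/-- The dimension of a cone (or of a face of a cone): the dimension of its linear span. -/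
noncomputable def dim (F : Set E) : ℕ := Module.finrank ℝ (Submodule.span ℝ F)

/-- An extreme ray of `C` is a face of dimension `1`. -/
def IsExtremeRay (C : PointedCone ℝ E) (R : Set E) : Prop := IsFace C R ∧ dim R = 1

/-- The set of extreme rays of `C`. -/
def extremeRays (C : PointedCone ℝ E) : Set (Set E) := {R | IsExtremeRay C R}

/-- Two different rays are adjacent on `C` if together they generate a face of `C` of
dimension `2`. -/
def AreAdjacent (C : PointedCone ℝ E) (R R' : Set E) : Prop :=
  R ≠ R' ∧ IsFace C (PointedCone.hull ℝ (R ∪ R') : Set E) ∧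
    dim (PointedCone.hull ℝ (R ∪ R') : Set E) = 2

/-- The 1-skeleton of `C`: the nodes are the extreme rays, the edges are the pairs of adjacent
extreme rays. -/
def skeleton (C : PointedCone ℝ E) : SimpleGraph (extremeRays C) where
  Adj R R' := AreAdjacent C R.1 R'.1
  symm := ⟨fun R R' h => by
    obtain ⟨h1, h2, h3⟩ := h
    rw [Set.union_comm] at h2 h3
    exact ⟨h1.symm, h2, h3⟩⟩
  loopless := ⟨fun _ h => h.1 rfl⟩

/-- A symmetry of `C` is a linear isometry of the ambient space that maps `C` onto itself. -/
def IsSymmetry (C : PointedCone ℝ E) (f : E ≃ₗᵢ[ℝ] E) : Prop := f '' (C : Set E) = C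

/-- The orbit of a face `F` of `C` under all symmetries of `C`. -/
def orbit (C : PointedCone ℝ E) (F : Set E) : Set (Set E) :=
  {F' | ∃ f : E ≃ₗᵢ[ℝ] E, IsSymmetry C f ∧ F' = f '' F}

/-- The subgraph of the skeleton of `C` that is induced by the extreme rays in `O`. -/
def skeletonOn (C : PointedCone ℝ E) (O : Set (Set E)) :
    SimpleGraph {R : extremeRays C | R.1 ∈ O} :=
  (skeleton C).induce {R : extremeRays C | R.1 ∈ O}

/-- The ray generated by `x`. -/
def ray (x : E) : Set E := (PointedCone.hull ℝ {x} : Set E)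

end Cone

/-! ### Partition hemimetrics

The `n`-set is `Fin n`. -/

section Partition

variable {n m : ℕ}

/-- The blocks `S 0, …, S m` form a partition of the `n`-set into `m + 1` nonempty blocks. -/
def IsPartition (S : Fin (m + 1) → Finset (Fin n)) : Prop :=
  (∀ k, (S k).Nonempty) ∧ (∀ k l, k ≠ l → Disjoint (S k) (S l)) ∧ ∀ i, ∃ k, i ∈ S k

/-- The partition `m`-hemimetric of `S`, as a function of `m + 1` points: it is `1` if no two of
the points (at different positions) lie in the same block, and `0` otherwise. -/
def partitionHemimetric (S : Fin (m + 1) → Finset (Fin n)) (x : Fin (m + 1) → Fin n) : ℝ :=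
  if ∀ j l, j < l → ∀ k, ¬ (x j ∈ S k ∧ x l ∈ S k) then 1 else 0

/-- The Euclidean space with coordinates indexed by the `(m + 1)`-subsets of the `n`-set. -/
abbrev Space (n m : ℕ) : Type :=
  EuclideanSpace ℝ {s : Finset (Fin n) // s.card = m + 1}

/-- A (totally symmetric) function of `m + 1` points, viewed as a vector: the coordinate at an
`(m + 1)`-subset is the value at its elements (listed in increasing order). -/
def toVector (d : (Fin (m + 1) → Fin n) → ℝ) : Space n m :=
  WithLp.toLp 2 fun s => d (s.1.orderEmbOfFin s.2)

/-- The vector `α(S₁, …, Sₘ₊₁)` of the partition `m`-hemimetric of `S`. -/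
def α (S : Fin (m + 1) → Finset (Fin n)) : Space n m := toVector (partitionHemimetric S)

/-- The coordinate of `α S` at `s` is `1` if `s` meets no block in two or more points, and `0`
otherwise. -/
theorem α_apply (S : Fin (m + 1) → Finset (Fin n)) (s : {s : Finset (Fin n) // s.card = m + 1}) :
    α S s = if ∀ k, (s.1 ∩ S k).card ≤ 1 then 1 else 0 := by
  have key : (∀ j l, j < l → ∀ k, ¬ (s.1.orderEmbOfFin s.2 j ∈ S k ∧
      s.1.orderEmbOfFin s.2 l ∈ S k)) ↔ ∀ k, (s.1 ∩ S k).card ≤ 1 := by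
    constructor
    · intro h k
      rw [Finset.card_le_one]
      intro a ha b hb
      rw [Finset.mem_inter] at ha hb
      have hr : Set.range (s.1.orderEmbOfFin s.2) = (s.1 : Set (Fin n)) :=
        Finset.range_orderEmbOfFin _ _
      obtain ⟨j, rfl⟩ : a ∈ Set.range (s.1.orderEmbOfFin s.2) := by rw [hr]; exact ha.1
      obtain ⟨l, rfl⟩ : b ∈ Set.range (s.1.orderEmbOfFin s.2) := by rw [hr]; exact hb.1
      rcases lt_trichotomy j l with hjl | hjl | hjl
      · exact absurd ⟨ha.2, hb.2⟩ (h j l hjl k)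
      · rw [hjl]
      · exact absurd ⟨hb.2, ha.2⟩ (h l j hjl k)
    · intro h j l hjl k hk
      have := Finset.card_le_one.1 (h k) _
        (Finset.mem_inter.2 ⟨Finset.orderEmbOfFin_mem s.1 s.2 j, hk.1⟩) _
        (Finset.mem_inter.2 ⟨Finset.orderEmbOfFin_mem s.1 s.2 l, hk.2⟩)
      exact hjl.ne ((s.1.orderEmbOfFin s.2).injective this)
  simp only [α, toVector, partitionHemimetric, key]

/-- The vectors of all partition `m`-hemimetrics on the `n`-set. -/
def partitionVectors (n m : ℕ) : Set (Space n m) :=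
  {v | ∃ S : Fin (m + 1) → Finset (Fin n), IsPartition S ∧ v = α S}

/-- The cone of partition `m`-hemimetrics on the `n`-set. -/
noncomputable def partitionCone (n m : ℕ) : PointedCone ℝ (Space n m) :=
  PointedCone.hull ℝ (partitionVectors n m)

/-- The partition obtained from `S` by a permutation of the points. -/
def permute (σ : Equiv.Perm (Fin n)) (S : Fin (m + 1) → Finset (Fin n)) :
    Fin (m + 1) → Finset (Fin n) :=
  fun k => (S k).map σ.toEmbedding

end Partition

/-! ### The case `n = 6`, `m = 3`

The points `1, …, 6` are written `0, …, 5`. -/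

/-- The orbit of the extreme ray of `α(1, 2, 3, 456)`. -/
def O₁ : Set (Set (Space 6 3)) :=
  orbit (partitionCone 6 3) (ray (α ![{0}, {1}, {2}, {3, 4, 5}]))

/-- The orbit of the extreme ray of `α(1, 2, 34, 56)`. -/
def O₂ : Set (Set (Space 6 3)) :=
  orbit (partitionCone 6 3) (ray (α ![{0}, {1}, {2, 3}, {4, 5}]))

/-- The partition `(12, 34, 5, 6)`. -/
def basePartition : Fin 4 → Finset (Fin 6) := ![{0, 1}, {2, 3}, {4}, {5}]

/-- The partitions `(12, 3, 4, 56)`, `(1, 2, 34, 56)`, `(125, 3, 4, 6)`, `(126, 3, 4, 5)`,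
`(345, 1, 2, 6)`, `(346, 1, 2, 5)`. -/
def nonNeighbours : Set (Fin 4 → Finset (Fin 6)) :=
  {![{0, 1}, {2}, {3}, {4, 5}],
   ![{0}, {1}, {2, 3}, {4, 5}],
   ![{0, 1, 4}, {2}, {3}, {5}],
   ![{0, 1, 5}, {2}, {3}, {4}],
   ![{2, 3, 4}, {0}, {1}, {5}],
   ![{2, 3, 5}, {0}, {1}, {4}]}

/-- The graph `K₄₅ - 15 K₃`: the complete graph on `45` nodes with the edges of `15` disjoint
triangles removed. -/
def K45Minus15K3 : SimpleGraph (Fin 15 × Fin 3) :=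
  (⊤ : SimpleGraph (Fin 15 × Fin 3)) \ ((⊥ : SimpleGraph (Fin 15)) □ (⊤ : SimpleGraph (Fin 3)))

end Hemimetric

/-! Replace each 4-subset of the six points by its complement, an edge of K₆. Then α(1,2,3,456) is
the indicator of the triangle 456, and α(12,34,5,6) that of the 4-cycle with diagonals 12 and 34;
the generators are the 20 triangles and 45 4-cycles of K₆. None of these edge sets contains another,
so minus the number of edges outside one of them exposes its ray (`isExposedFamily_gen`). Two
triangles sharing an edge differ by a 4-cycle, which puts every unit vector in the span
(`span_gen`).

Two rays are non-adjacent exactly when they are `Separated`. In that case their union splits into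
generators in another way: with C(12,34) for the 4-cycle above, C(12,34) + C(12,56) = C(12,35) +
C(12,46), and 125 + C(12,34) = 123 + C(12,45). A face containing both rays then contains a third
(`not_areAdjacent_of_separated`). Otherwise a functional is built in two stages: one cuts out the
generators inside the union, and `pairWeight` isolates the pair among those (`areAdjacent_of_lt`).
Diameter, induced subgraphs and non-edges are then finite checks on `Separated`.

Point permutations are transitive on triangles and on 4-cycles. No symmetry merges the two classes:
two triangles with one common edge have cosine 1/3, and no generator has cosine 1/3 with a 4-cycle
(`IsSymmetry.image_ray_ne`). -/

namespace Hemimetric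

/-! ### Faces of finitely generated cones. -/

section ConeTheory

variable {E : Type*} [NormedAddCommGroup E] [InnerProductSpace ℝ E]

theorem inner_nonpos_of_mem_hull {G : Set E} {v : E} (hv : ∀ g ∈ G, inner ℝ v g ≤ 0) {x : E}
    (hx : x ∈ PointedCone.hull ℝ G) : inner ℝ v x ≤ 0 := by
  induction hx using Submodule.span_induction with
  | mem x h => exact hv x h
  | zero => simp
  | add x y _ _ hx hy => rw [inner_add_right]; linarith
  | smul c x _ hx =>
    have : inner ℝ v (c • x) = (c : ℝ) * inner ℝ v x := inner_smul_right v x (c : ℝ)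
    rw [this]
    exact mul_nonpos_of_nonneg_of_nonpos c.2 hx

/-- Nonpositive summands with sum zero all vanish, so only generators on the hyperplane contribute.
-/
theorem mem_hull_of_inner_eq_zero {G : Set E} {v : E} (hv : ∀ g ∈ G, inner ℝ v g ≤ 0) {x : E}
    (hx : x ∈ PointedCone.hull ℝ G) (h0 : inner ℝ v x = 0) :
    x ∈ PointedCone.hull ℝ {g ∈ G | inner ℝ v g = 0} := by
  induction hx using Submodule.span_induction with
  | mem x h => exact Submodule.subset_span ⟨h, h0⟩
  | zero => exact zero_mem _
  | add x y hx' hy' hx hy =>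
    have h1 := inner_nonpos_of_mem_hull hv hx'
    have h2 := inner_nonpos_of_mem_hull hv hy'
    rw [inner_add_right] at h0
    exact add_mem (hx (by linarith)) (hy (by linarith))
  | smul c x _ hx =>
    have : inner ℝ v (c • x) = (c : ℝ) * inner ℝ v x := inner_smul_right v x (c : ℝ)
    rw [this] at h0
    rcases mul_eq_zero.1 h0 with h | h
    · have : c = 0 := Subtype.ext h
      rw [this, zero_smul]
      exact zero_mem _
    · exact Submodule.smul_mem _ _ (hx h)

/-- The face of a finitely generated cone is generated by the generators on it. -/
theorem face_eq_hull {G : Set E} {v : E} (hv : ∀ g ∈ G, inner ℝ v g ≤ 0) :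
    {x : E | x ∈ PointedCone.hull ℝ G ∧ inner ℝ v x = 0} =
      (PointedCone.hull ℝ {g ∈ G | inner ℝ v g = 0} : Set E) := by
  ext x
  constructor
  · rintro ⟨hx, h0⟩
    exact mem_hull_of_inner_eq_zero hv hx h0
  · intro hx
    refine ⟨Submodule.span_mono (Set.sep_subset _ _) hx, ?_⟩
    have h1 : inner ℝ v x ≤ 0 := inner_nonpos_of_mem_hull (fun g hg => hg.2.le) hx
    have h2 : inner ℝ (-v) x ≤ 0 :=
      inner_nonpos_of_mem_hull (fun g hg => by rw [inner_neg_left, hg.2, neg_zero]) hx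
    rw [inner_neg_left] at h2
    linarith

theorem dim_hull (G : Set E) :
    dim (PointedCone.hull ℝ G : Set E) = Module.finrank ℝ (Submodule.span ℝ G) := by
  have : Submodule.span ℝ (PointedCone.hull ℝ G : Set E) = Submodule.span ℝ G :=
    Submodule.span_span_of_tower _ ℝ G
  rw [dim, this]

theorem mem_ray_iff {x y : E} : y ∈ ray x ↔ ∃ c : ℝ, 0 ≤ c ∧ y = c • x := by
  change y ∈ Submodule.span _ {x} ↔ _
  rw [Submodule.mem_span_singleton]
  constructor
  · rintro ⟨c, rfl⟩
    exact ⟨c, c.2, rfl⟩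
  · rintro ⟨c, hc, rfl⟩
    exact ⟨⟨c, hc⟩, rfl⟩

theorem self_mem_ray (x : E) : x ∈ ray x := mem_ray_iff.2 ⟨1, zero_le_one, (one_smul ℝ x).symm⟩

theorem hull_ray_union (x y : E) :
    PointedCone.hull ℝ (ray x ∪ ray y) = PointedCone.hull ℝ {x, y} := by
  apply le_antisymm
  · refine Submodule.span_le.2 (Set.union_subset ?_ ?_)
    · exact Submodule.span_mono (by simp)
    · exact Submodule.span_mono (by simp)
  · refine Submodule.span_mono ?_
    rintro z (rfl | rfl)
    · exact Or.inl (self_mem_ray _)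
    · exact Or.inr (self_mem_ray _)

/-- A face of a face of a finitely generated cone is exposed. -/
theorem exists_inner_lex {G : Set E} (hG : G.Finite) {v₁ v₂ : E}
    (h1 : ∀ g ∈ G, inner ℝ v₁ g ≤ 0) (h2 : ∀ g ∈ G, inner ℝ v₁ g = 0 → inner ℝ v₂ g ≤ 0) :
    ∃ v : E, (∀ g ∈ G, inner ℝ v g ≤ 0) ∧
      ∀ g ∈ G, (inner ℝ v g = 0 ↔ inner ℝ v₁ g = 0 ∧ inner ℝ v₂ g = 0) := by
  -- Beyond this bound `v₂ + B • v₁` is negative off the hyperplane of `v₁`. On it the quotient has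
  -- the default value 0, which is harmless because the bound is not used there.
  obtain ⟨B, hB⟩ : ∃ B : ℝ, ∀ g ∈ G, inner ℝ v₂ g / (-inner ℝ v₁ g) < B := by
    obtain ⟨B, hB⟩ := (hG.image fun g => inner ℝ v₂ g / (-inner ℝ v₁ g)).bddAbove
    exact ⟨B + 1, fun g hg => lt_of_le_of_lt (hB ⟨g, hg, rfl⟩) (lt_add_one B)⟩
  have key : ∀ g, inner ℝ (v₂ + B • v₁) g = inner ℝ v₂ g + B * inner ℝ v₁ g := fun g => by
    rw [inner_add_left, real_inner_smul_left]
  have hlt : ∀ g ∈ G, inner ℝ v₁ g ≠ 0 → inner ℝ (v₂ + B • v₁) g < 0 := fun g hg hne => by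
    have := hB g hg
    rw [div_lt_iff₀ (by have := lt_of_le_of_ne (h1 g hg) hne; linarith)] at this
    rw [key]
    linarith
  refine ⟨v₂ + B • v₁, fun g hg => ?_, fun g hg => ?_⟩
  · by_cases h : inner ℝ v₁ g = 0
    · rw [key, h, mul_zero, add_zero]
      exact h2 g hg h
    · exact (hlt g hg h).le
  · by_cases h : inner ℝ v₁ g = 0
    · rw [key, h, mul_zero, add_zero]
      simp
    · simp [h, (hlt g hg h).ne]

/-! ### Families of exposed vectors -/

/-- Every member of the family `g` spans an exposed ray, and different members different rays. -/
def IsExposedFamily {ι : Type*} (g : ι → E) : Prop :=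
  ∀ i, ∃ v : E, ∀ j, inner ℝ v (g j) ≤ 0 ∧ (inner ℝ v (g j) = 0 ↔ j = i)

namespace IsExposedFamily

variable {ι : Type*} {g : ι → E} (h : IsExposedFamily g)

include h

/-- The functional exposing another member is nonzero at `g i`. A family with one member could
consist of the zero vector. -/
theorem ne_zero [Nontrivial ι] (i : ι) : g i ≠ 0 := by
  intro h0
  obtain ⟨j, hj⟩ := exists_ne i
  obtain ⟨v, hv⟩ := h j
  have := (hv i).2.1 (by rw [h0, inner_zero_right])
  exact hj this.symm

theorem eq_of_smul_eq {i j : ι} [Nontrivial ι] {c : ℝ} (hc : g i = c • g j) : i = j := by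
  obtain ⟨v, hv⟩ := h j
  refine (hv i).2.1 ?_
  rw [hc, real_inner_smul_right, (hv j).2.2 rfl, mul_zero]

theorem ray_injective [Nontrivial ι] : Function.Injective fun i => ray (g i) := by
  intro i j hij
  have : g i ∈ ray (g j) := by
    have hij : ray (g i) = ray (g j) := hij
    rw [← hij]
    exact self_mem_ray _
  obtain ⟨c, -, hc⟩ := mem_ray_iff.1 this
  exact h.eq_of_smul_eq hc

theorem isExtremeRay [Nontrivial ι] (i : ι) :
    IsExtremeRay (PointedCone.hull ℝ (Set.range g)) (ray (g i)) := by
  constructor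
  · obtain ⟨v, hv⟩ := h i
    have hG : ∀ x ∈ Set.range g, inner ℝ v x ≤ 0 := by
      rintro _ ⟨j, rfl⟩
      exact (hv j).1
    refine ⟨v, fun x hx => inner_nonpos_of_mem_hull hG hx, ?_⟩
    rw [face_eq_hull hG]
    have : {x ∈ Set.range g | inner ℝ v x = 0} = {g i} := by
      ext x
      constructor
      · rintro ⟨⟨j, rfl⟩, hj⟩
        rw [(hv j).2.1 hj]
        rfl
      · rintro rfl
        exact ⟨⟨i, rfl⟩, (hv i).2.2 rfl⟩
    rw [this]
    rfl
  · rw [ray, dim_hull]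
    exact finrank_span_singleton (h.ne_zero i)

/-- A face is generated by the members of `g` on it. If its dimension is 1, these are proportional
to each other, hence a single member. -/
theorem extremeRays_eq [Nontrivial ι] :
    extremeRays (PointedCone.hull ℝ (Set.range g)) = Set.range fun i => ray (g i) := by
  ext R
  constructor
  · rintro ⟨⟨v, hv, rfl⟩, hd⟩
    have hG : ∀ x ∈ Set.range g, inner ℝ v x ≤ 0 := fun x hx => hv x (Submodule.subset_span hx)
    rw [face_eq_hull hG] at hd ⊢
    rw [dim_hull] at hd
    have hne : {x ∈ Set.range g | inner ℝ v x = 0}.Nonempty := by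
      by_contra he
      rw [Set.not_nonempty_iff_eq_empty] at he
      rw [he, Submodule.span_empty, finrank_bot] at hd
      exact zero_ne_one hd
    obtain ⟨_, ⟨i, rfl⟩, hi⟩ := hne
    refine ⟨i, ?_⟩
    have : {x ∈ Set.range g | inner ℝ v x = 0} = {g i} := by
      ext x
      constructor
      · rintro ⟨⟨j, rfl⟩, hj⟩
        have hi' : g i ∈ Submodule.span ℝ {x ∈ Set.range g | inner ℝ v x = 0} :=
          Submodule.subset_span ⟨⟨i, rfl⟩, hi⟩
        have hj' : g j ∈ Submodule.span ℝ {x ∈ Set.range g | inner ℝ v x = 0} :=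
          Submodule.subset_span ⟨⟨j, rfl⟩, hj⟩
        obtain ⟨c, hc⟩ := (finrank_eq_one_iff_of_nonzero' (⟨g i, hi'⟩ : Submodule.span ℝ _)
          (fun h0 => h.ne_zero i (congrArg Subtype.val h0))).1 hd ⟨g j, hj'⟩
        have hc : c • g i = g j := congrArg Subtype.val hc
        rw [h.eq_of_smul_eq hc.symm]
        rfl
      · rintro rfl
        exact ⟨⟨i, rfl⟩, hi⟩
    rw [this]
    rfl
  · rintro ⟨i, rfl⟩
    exact h.isExtremeRay i

/-- The functional exposing one of the two vectors isolates the coefficient of the other. -/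
theorem linearIndependent_pair [Nontrivial ι] {i j : ι} (hij : i ≠ j) :
    LinearIndependent ℝ ![g i, g j] := by
  rw [LinearIndependent.pair_iff]
  intro s t hst
  obtain ⟨u, hu⟩ := h i
  obtain ⟨v, hv⟩ := h j
  have h1 := congrArg (inner ℝ u) hst
  have h2 := congrArg (inner ℝ v) hst
  rw [inner_add_right, real_inner_smul_right, real_inner_smul_right, inner_zero_right] at h1 h2
  rw [(hu i).2.2 rfl, mul_zero, zero_add, mul_eq_zero, (hu j).2] at h1
  rw [(hv j).2.2 rfl, mul_zero, add_zero, mul_eq_zero, (hv i).2] at h2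
  exact ⟨h2.resolve_right hij, h1.resolve_right hij.symm⟩

theorem areAdjacent_of_inner [Nontrivial ι] {i j : ι} (hij : i ≠ j) {v : E}
    (hv : ∀ k, inner ℝ v (g k) ≤ 0) (hv0 : ∀ k, inner ℝ v (g k) = 0 ↔ k = i ∨ k = j) :
    AreAdjacent (PointedCone.hull ℝ (Set.range g)) (ray (g i)) (ray (g j)) := by
  refine ⟨fun he => hij (h.ray_injective he), ?_, ?_⟩
  · have hG : ∀ x ∈ Set.range g, inner ℝ v x ≤ 0 := by
      rintro _ ⟨k, rfl⟩
      exact hv k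
    refine ⟨v, fun x hx => inner_nonpos_of_mem_hull hG hx, ?_⟩
    rw [face_eq_hull hG, hull_ray_union]
    congr 2
    ext x
    constructor
    · rintro (rfl | rfl)
      · exact ⟨⟨i, rfl⟩, (hv0 i).2 (Or.inl rfl)⟩
      · exact ⟨⟨j, rfl⟩, (hv0 j).2 (Or.inr rfl)⟩
    · rintro ⟨⟨k, rfl⟩, hk⟩
      rcases (hv0 k).1 hk with rfl | rfl
      · exact Or.inl rfl
      · exact Or.inr rfl
  · rw [hull_ray_union, dim_hull]
    have := finrank_span_eq_card (h.linearIndependent_pair hij)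
    rwa [Matrix.range_cons_cons_empty, Fintype.card_fin] at this

/-- A supporting functional that vanishes at `g i` and `g j` is nonpositive with sum zero at `g k`
and `g l`, so `g k` lies on the face too. Being exposed, `g k` is no nonnegative combination of `g
i` and `g j`. -/
theorem not_areAdjacent_of_add_eq {i j k l : ι} (hki : k ≠ i) (hkj : k ≠ j) [Nontrivial ι]
    (hs : g i + g j = g k + g l) :
    ¬ AreAdjacent (PointedCone.hull ℝ (Set.range g)) (ray (g i)) (ray (g j)) := by
  rintro ⟨-, ⟨v, hv, hF⟩, -⟩
  rw [hull_ray_union] at hF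
  have hmem : ∀ m, g m ∈ PointedCone.hull ℝ (Set.range g) :=
    fun m => Submodule.subset_span ⟨m, rfl⟩
  have hi : inner ℝ v (g i) = 0 := by
    have : g i ∈ (PointedCone.hull ℝ {g i, g j} : Set E) := Submodule.subset_span (by simp)
    rw [hF] at this
    exact this.2
  have hj : inner ℝ v (g j) = 0 := by
    have : g j ∈ (PointedCone.hull ℝ {g i, g j} : Set E) := Submodule.subset_span (by simp)
    rw [hF] at this
    exact this.2
  have hk : inner ℝ v (g k) = 0 := by
    have h1 := congrArg (inner ℝ v) hs
    rw [inner_add_right, inner_add_right, hi, hj] at h1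
    have h2 := hv _ (hmem k)
    have h3 := hv _ (hmem l)
    linarith
  have hk' : g k ∈ (PointedCone.hull ℝ {g i, g j} : Set E) := by
    rw [hF]
    exact ⟨hmem k, hk⟩
  obtain ⟨s, t, hs, ht, hst⟩ : ∃ s t : ℝ, 0 ≤ s ∧ 0 ≤ t ∧ g k = s • g i + t • g j := by
    obtain ⟨s, t, h⟩ := Submodule.mem_span_pair.1 hk'
    exact ⟨s, t, s.2, t.2, h.symm⟩
  obtain ⟨u, hu⟩ := h k
  have h1 := congrArg (inner ℝ u) hst
  rw [inner_add_right, real_inner_smul_right, real_inner_smul_right, (hu k).2.2 rfl] at h1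
  have hui : inner ℝ u (g i) < 0 :=
    lt_of_le_of_ne (hu i).1 fun h0 => hki ((hu i).2.1 h0).symm
  have huj : inner ℝ u (g j) < 0 :=
    lt_of_le_of_ne (hu j).1 fun h0 => hkj ((hu j).2.1 h0).symm
  have hsz : s = 0 := by nlinarith
  have htz : t = 0 := by nlinarith
  rw [hsz, htz, zero_smul, zero_smul, add_zero] at hst
  exact h.ne_zero k hst

end IsExposedFamily

/-! ### Symmetries -/

section Symmetry

variable {C : PointedCone ℝ E} {f f' : E ≃ₗᵢ[ℝ] E}

theorem IsSymmetry.mem_iff (hf : IsSymmetry C f) {x : E} : f x ∈ C ↔ x ∈ C := by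
  have hf : f '' (C : Set E) = C := hf
  constructor
  · intro hx
    have hx : f x ∈ (C : Set E) := hx
    rw [← hf] at hx
    obtain ⟨y, hy, hyx⟩ := hx
    rwa [← f.injective hyx]
  · intro hx
    have : f x ∈ (C : Set E) := by
      rw [← hf]
      exact ⟨x, hx, rfl⟩
    exact this

theorem IsSymmetry.symm (hf : IsSymmetry C f) : IsSymmetry C f.symm := by
  have hf' : f '' (C : Set E) = C := hf
  unfold IsSymmetry
  conv_lhs => rw [← hf']
  rw [Set.image_image]
  simp

theorem IsSymmetry.trans (hf : IsSymmetry C f) (hf' : IsSymmetry C f') :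
    IsSymmetry C (f.trans f') := by
  unfold IsSymmetry at *
  rw [LinearIsometryEquiv.coe_trans, Set.image_comp, hf, hf']

/-- The inverse of an isometry is its adjoint, so `f v` cuts out the image. -/
theorem IsSymmetry.isFace_image (hf : IsSymmetry C f) {F : Set E} (hF : IsFace C F) :
    IsFace C (f '' F) := by
  obtain ⟨v, hv, rfl⟩ := hF
  have key : ∀ x, inner ℝ (f v) x = inner ℝ v (f.symm x) := fun x => by
    rw [← f.inner_map_map v (f.symm x), f.apply_symm_apply]
  refine ⟨f v, fun x hx => ?_, ?_⟩
  · rw [key]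
    exact hv _ (hf.symm.mem_iff.2 hx)
  · ext x
    constructor
    · rintro ⟨y, ⟨hy, h0⟩, rfl⟩
      exact ⟨hf.mem_iff.2 hy, by rw [f.inner_map_map, h0]⟩
    · rintro ⟨hx, h0⟩
      exact ⟨f.symm x, ⟨hf.symm.mem_iff.2 hx, by rw [← key, h0]⟩, f.apply_symm_apply x⟩

theorem dim_image (f : E ≃ₗᵢ[ℝ] E) (F : Set E) : dim (f '' F) = dim F := by
  unfold dim
  have : Submodule.span ℝ (f '' F) = (Submodule.span ℝ F).map f.toLinearEquiv.toLinearMap := by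
    rw [Submodule.map_span]
    rfl
  rw [this]
  exact LinearEquiv.finrank_map_eq f.toLinearEquiv _

theorem image_hull (f : E ≃ₗᵢ[ℝ] E) (G : Set E) :
    f '' (PointedCone.hull ℝ G : Set E) = (PointedCone.hull ℝ (f '' G) : Set E) := by
  have := Submodule.map_span
    (f.toLinearEquiv.toLinearMap.restrictScalars {c : ℝ // 0 ≤ c}) G
  exact congrArg (fun S : Submodule {c : ℝ // 0 ≤ c} E => (S : Set E)) this

theorem image_ray (f : E ≃ₗᵢ[ℝ] E) (x : E) : f '' ray x = ray (f x) := by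
  rw [ray, image_hull, Set.image_singleton]
  rfl

theorem IsSymmetry.isExtremeRay_image (hf : IsSymmetry C f) {R : Set E} (hR : IsExtremeRay C R) :
    IsExtremeRay C (f '' R) :=
  ⟨hf.isFace_image hR.1, by rw [dim_image, hR.2]⟩

theorem IsSymmetry.areAdjacent_image (hf : IsSymmetry C f) {R R' : Set E}
    (h : AreAdjacent C R R') : AreAdjacent C (f '' R) (f '' R') := by
  obtain ⟨h1, h2, h3⟩ := h
  refine ⟨fun he => h1 (f.injective.image_injective he), ?_, ?_⟩
  · rw [← Set.image_union, ← image_hull]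
    exact hf.isFace_image h2
  · rw [← Set.image_union, ← image_hull, dim_image, h3]

theorem image_symm_image (f : E ≃ₗᵢ[ℝ] E) (F : Set E) : f.symm '' (f '' F) = F := by
  rw [Set.image_image]
  simp

theorem IsSymmetry.areAdjacent_image_iff (hf : IsSymmetry C f) {R R' : Set E} :
    AreAdjacent C (f '' R) (f '' R') ↔ AreAdjacent C R R' := by
  refine ⟨fun h => ?_, hf.areAdjacent_image⟩
  have := hf.symm.areAdjacent_image h
  rwa [image_symm_image, image_symm_image] at this

theorem mem_orbit_self (C : PointedCone ℝ E) (F : Set E) : F ∈ orbit C F :=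
  ⟨LinearIsometryEquiv.refl ℝ E, by simp [IsSymmetry], by simp⟩

theorem IsSymmetry.orbit_image (hf : IsSymmetry C f) (F : Set E) :
    orbit C (f '' F) = orbit C F := by
  ext F'
  constructor
  · rintro ⟨k, hk, rfl⟩
    exact ⟨f.trans k, hf.trans hk, by rw [LinearIsometryEquiv.coe_trans, Set.image_comp]⟩
  · rintro ⟨k, hk, rfl⟩
    refine ⟨f.symm.trans k, hf.symm.trans hk, ?_⟩
    rw [LinearIsometryEquiv.coe_trans, Set.image_comp, image_symm_image]

end Symmetry

end ConeTheory

/-! ### Bit masks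

The fifteen `4`-subsets of the `6`-set, in lexicographic order, are the bits of a mask. -/

/-- Whether four colours below `4` are distinct. -/
def rainbow (a b c d : ℕ) : Bool := (2 ^ a ||| 2 ^ b ||| 2 ^ c ||| 2 ^ d) == 15

/-- The number with the given binary digits. -/
def ofDigits : List Bool → ℕ
  | [] => 0
  | b :: l => b.toNat + 2 * ofDigits l

/-- The number of ones among the last `15` binary digits of `m`. -/
def popCount (m : ℕ) : ℕ :=
  m % 2 + m / 2 % 2 + m / 4 % 2 + m / 8 % 2 + m / 16 % 2 + m / 32 % 2 + m / 64 % 2 + m / 128 %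
    2 + m / 256 % 2 + m / 512 % 2 + m / 1024 % 2 + m / 2048 % 2 + m / 4096 % 2 + m / 8192 % 2
    + m / 16384 % 2

/-- The `4`-subsets that are rainbow for the colouring `x0, …, x5`. -/
def rainbows (x0 x1 x2 x3 x4 x5 : ℕ) : List Bool :=
  let r := rainbow
  [
    r x0 x1 x2 x3, r x0 x1 x2 x4, r x0 x1 x2 x5, r x0 x1 x3 x4, r x0 x1 x3 x5, r x0 x1 x4 x5,
    r x0 x2 x3 x4, r x0 x2 x3 x5, r x0 x2 x4 x5, r x0 x3 x4 x5, r x1 x2 x3 x4, r x1 x2 x3 x5,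
    r x1 x2 x4 x5, r x1 x3 x4 x5, r x2 x3 x4 x5]

/-- The mask of the `4`-subsets that are rainbow for a colouring. -/
def mask (c : Fin 6 → Fin 4) : ℕ :=
  ofDigits (rainbows (c 0) (c 1) (c 2) (c 3) (c 4) (c 5))

/-- The masks of the partition hemimetrics, each with the mask of the complements of the pairs
that lie in one block. In terms of complements, the first `20` masks are the triangles of the
complete graph on `6` nodes, the other `45` are its `4`-cycles, and the second mask of a
`4`-cycle consists of its two diagonals. -/
def table : List (ℕ × ℕ) :=
  [
    (7, 7), (25, 25), (42, 42), (52, 52), (193, 193), (322, 322), (388, 388), (584, 584),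
    (656, 656), (800, 800), (3073, 3073), (5122, 5122), (6148, 6148), (9224, 9224),
    (10256, 10256), (12320, 12320), (17472, 17472), (18560, 18560), (20736, 20736),
    (25088, 25088), (13056, 16416), (30, 33), (3264, 16385), (10880, 16400), (45, 18),
    (5440, 16386), (9792, 16392), (51, 12), (6528, 16388), (21024, 8448), (198, 257),
    (3096, 8193), (18960, 8320), (325, 130), (5160, 8194), (17928, 8256), (387, 68),
    (6192, 8196), (24864, 4608), (216, 513), (3078, 4097), (18692, 4224), (593, 136),
    (9250, 4104), (17666, 4160), (649, 80), (10276, 4112), (24720, 2560), (360, 514),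
    (5125, 2050), (20612, 2304), (610, 264), (9233, 2056), (17537, 2112), (778, 96),
    (12308, 2080), (24648, 1536), (432, 516), (6147, 1028), (20546, 1280), (676, 272),
    (10249, 1040), (18497, 1152), (788, 160), (12298, 1056)]

/-- Permutations `τ` of the points such that the `i`-th partition is the inverse image under `τ`
of `(1, 2, 3, 456)` or `(12, 34, 5, 6)`; the octal digits are the values of `τ`. -/
def codes : List ℕ :=
  [
    0o543210, 0o542310, 0o524310, 0o254310, 0o542130, 0o524130, 0o254130, 0o521430, 0o251430,
    0o215430, 0o542103, 0o524103, 0o254103, 0o521403, 0o251403, 0o215403, 0o521043, 0o251043,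
    0o215043, 0o210543, 0o543210, 0o321054, 0o105432, 0o534210, 0o312054, 0o150432, 0o354210,
    0o132054, 0o510432, 0o543120, 0o321504, 0o105342, 0o534120, 0o312504, 0o150342, 0o354120,
    0o132504, 0o510342, 0o541320, 0o325104, 0o103542, 0o531420, 0o315204, 0o153042, 0o351420,
    0o135204, 0o513042, 0o514320, 0o352104, 0o130542, 0o513420, 0o351204, 0o135042, 0o315420,
    0o153204, 0o531042, 0o154320, 0o532104, 0o310542, 0o153420, 0o531204, 0o315042, 0o135420,
    0o513204, 0o351042]

/-- The map whose values are the octal digits of `n`. -/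
def digitMap (n : ℕ) (x : Fin 6) : Fin 6 := Fin.ofNat 6 (n / 8 ^ (x : ℕ) % 8)

/-- The condition on two rows of the table for the rays not to be adjacent: the cycles have no
common edge, but the pairs of points inside a block (for a triangle, its edges) have. -/
def Separated (a b : ℕ × ℕ) : Prop := a.1 &&& b.1 = 0 ∧ a.2 &&& b.2 ≠ 0

instance (a b : ℕ × ℕ) : Decidable (Separated a b) := inferInstanceAs (Decidable (_ ∧ _))

/-- A linear function of the mask `c` that vanishes at the masks of `a` and `b`. -/
def pairWeight (a b : ℕ × ℕ) (c : ℕ) : ℤ :=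
  let p (m : ℕ) : ℤ := popCount m
  -- The diagonals of a 4-cycle; empty for a triangle.
  let a' := a.2 ^^^ (a.2 &&& a.1)
  let b' := b.2 ^^^ (b.2 &&& b.1)
  let k := p (a.1 &&& b.1)
  let n := p a.1
  let m := p b.1
  let d := p (a.1 &&& b')
  let e := p (b.1 &&& a')
  -- The bracketed count equals `d - k` at `a.1` and `e - k` at `b.1`. By Cramer's rule for the Gram
  -- matrix with rows (n, k) and (k, m), the other two terms cancel these values, after
  -- multiplication by the determinant `n * m - k * k`.
  (n * m - k * k) * (p (a.1 &&& b' &&& c) + p (b.1 &&& a' &&& c) - p (a.1 &&& b.1 &&& c)) +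
    (k * (e + m - k) - m * d) * p (a.1 &&& c) + (k * (d + n - k) - n * e) * p (b.1 &&& c)

/-! ### Finite checks on the table. -/

set_option maxRecDepth 100000

/-- The value 15 means that all four colours occur. -/
theorem mask_mem_table : ∀ a b c d e f : Fin 4,
    (2 ^ (a : ℕ) ||| 2 ^ (b : ℕ) ||| 2 ^ (c : ℕ) ||| 2 ^ (d : ℕ) ||| 2 ^ (e : ℕ) |||
      2 ^ (f : ℕ) : ℕ) = 15 →
    ofDigits (rainbows a b c d e f) ∈ table.map Prod.fst := by
  decide +kernel

theorem table_antichain : ∀ a ∈ table, ∀ b ∈ table,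
    popCount (a.1 &&& b.1) ≤ popCount b.1 ∧
      (popCount (a.1 &&& b.1) = popCount b.1 ↔ b = a) := by
  decide +kernel

/-- The exchange behind non-adjacency: `c` lies in the union of the two disjoint edge sets, and `d`
is what it leaves over. -/
theorem separated_spec : ∀ a ∈ table, ∀ b ∈ table, Separated a b →
    ∃ c ∈ table, (a.1 ||| b.1) ||| c.1 = a.1 ||| b.1 ∧ c ≠ a ∧ c ≠ b ∧
      ∃ d ∈ table, d.1 = (a.1 ||| b.1) ^^^ c.1 := by
  decide +kernel

/-- Rows not contained in the union are exempt, since the first-stage functional is already negative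
there. -/
theorem pairWeight_spec : table.Pairwise fun a b => ¬ Separated a b →
    (table.all fun c =>
      (Nat.beq (Nat.lor (Nat.lor a.1 b.1) c.1) (Nat.lor a.1 b.1)).not ||
        decide (0 ≤ pairWeight a b c.1 ∧
          (pairWeight a b c.1 = 0 ↔ c.1 = a.1 ∨ c.1 = b.1))) = true := by
  decide +kernel

/-- The `4`-subsets of the `6`-set in lexicographic order. -/
def quad : Fin 15 → {s : Finset (Fin 6) // s.card = 3 + 1} :=
  ![
    ⟨{0, 1, 2, 3}, by decide⟩, ⟨{0, 1, 2, 4}, by decide⟩, ⟨{0, 1, 2, 5}, by decide⟩,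
    ⟨{0, 1, 3, 4}, by decide⟩, ⟨{0, 1, 3, 5}, by decide⟩, ⟨{0, 1, 4, 5}, by decide⟩,
    ⟨{0, 2, 3, 4}, by decide⟩, ⟨{0, 2, 3, 5}, by decide⟩, ⟨{0, 2, 4, 5}, by decide⟩,
    ⟨{0, 3, 4, 5}, by decide⟩, ⟨{1, 2, 3, 4}, by decide⟩, ⟨{1, 2, 3, 5}, by decide⟩,
    ⟨{1, 2, 4, 5}, by decide⟩, ⟨{1, 3, 4, 5}, by decide⟩, ⟨{2, 3, 4, 5}, by decide⟩]

theorem quad_bijective : Function.Bijective quad := by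
  rw [Fintype.bijective_iff_injective_and_card]
  exact ⟨by decide +kernel, by rw [Fintype.card_finset_len]; rfl⟩

noncomputable def quadEquiv : Fin 15 ≃ {s : Finset (Fin 6) // s.card = 3 + 1} :=
  Equiv.ofBijective quad quad_bijective

/-- The vector with the given mask. -/
noncomputable def vec (m : ℕ) : Space 6 3 :=
  WithLp.toLp 2 fun s => if m.testBit (quadEquiv.symm s) then 1 else 0

theorem vec_quad (m : ℕ) (i : Fin 15) : vec m (quad i) = if m.testBit i then 1 else 0 := by
  have : quadEquiv.symm (quad i) = i := quadEquiv.symm_apply_apply i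
  simp [vec, this]

theorem ext_quad {x y : Space 6 3} (h : ∀ i, x (quad i) = y (quad i)) : x = y := by
  ext s
  obtain ⟨i, rfl⟩ := quad_bijective.2 s
  exact h i

theorem vec_add_vec (a b : ℕ) : vec a + vec b = vec (a &&& b) + vec (a ||| b) := by
  refine ext_quad fun i => ?_
  simp only [PiLp.add_apply, vec_quad, Nat.testBit_and, Nat.testBit_or]
  cases a.testBit i <;> cases b.testBit i <;> norm_num

theorem vec_add_vec_xor (a b : ℕ) : vec a + vec b = (2 : ℝ) • vec (a &&& b) + vec (a ^^^ b) := by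
  refine ext_quad fun i => ?_
  simp only [PiLp.add_apply, PiLp.smul_apply, vec_quad, Nat.testBit_and, Nat.testBit_xor]
  cases a.testBit i <;> cases b.testBit i <;> norm_num

theorem popCount_eq_sum (m : ℕ) :
    (popCount m : ℝ) = ∑ i : Fin 15, if m.testBit i then 1 else 0 := by
  have key : ∀ i : ℕ, (if m.testBit i then (1 : ℝ) else 0) = ((m / 2 ^ i % 2 : ℕ) : ℝ) :=
    fun i => by
      rw [← Nat.toNat_testBit]
      cases m.testBit i <;> simp
  simp only [key]
  rw [← Nat.cast_sum]
  congr 1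
  simp [popCount, Fin.sum_univ_succ, add_assoc]

theorem inner_vec (a b : ℕ) : inner ℝ (vec a) (vec b) = (popCount (a &&& b) : ℝ) := by
  rw [popCount_eq_sum, PiLp.inner_apply, ← quadEquiv.sum_comp]
  refine Finset.sum_congr rfl fun i _ => ?_
  change inner ℝ (vec a (quad i)) (vec b (quad i)) = _
  rw [vec_quad, vec_quad, Nat.testBit_and]
  cases a.testBit i <;> cases b.testBit i <;> simp

/-! ### Masks of partitions -/

theorem testBit_ofDigits (l : List Bool) (i : ℕ) : (ofDigits l).testBit i = l.getD i false := by
  induction l generalizing i with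
  | nil => simp [ofDigits]
  | cons b l ih =>
    cases i with
    | zero => cases b <;> simp [ofDigits, Nat.testBit_zero]
    | succ i =>
      rw [Nat.testBit_succ, List.getD_cons_succ, ← ih]
      congr 1
      cases b
      · simp [ofDigits]
      · simp [ofDigits]
        omega

/-- `c` maps each point to the number of its block. -/
def IsColouring {n m : ℕ} (S : Fin (m + 1) → Finset (Fin n)) (c : Fin n → Fin (m + 1)) : Prop :=
  ∀ i k, i ∈ S k ↔ c i = k

theorem IsPartition.exists_isColouring {n m : ℕ} {S : Fin (m + 1) → Finset (Fin n)}
    (hS : IsPartition S) : ∃ c, IsColouring S c ∧ Function.Surjective c := by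
  obtain ⟨h1, h2, h3⟩ := hS
  choose c hc using h3
  have hcol : IsColouring S c := fun i k => by
    refine ⟨fun hi => ?_, fun hi => hi ▸ hc i⟩
    by_contra hne
    exact Finset.disjoint_left.1 (h2 _ _ hne) (hc i) hi
  refine ⟨c, hcol, fun k => ?_⟩
  obtain ⟨i, hi⟩ := h1 k
  exact ⟨i, (hcol i k).1 hi⟩

theorem IsColouring.isPartition {n m : ℕ} {S : Fin (m + 1) → Finset (Fin n)}
    {c : Fin n → Fin (m + 1)} (hc : IsColouring S c) (hs : Function.Surjective c) :
    IsPartition S := by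
  refine ⟨fun k => ?_, fun k l hkl => ?_, fun i => ⟨c i, (hc i _).2 rfl⟩⟩
  · obtain ⟨i, hi⟩ := hs k
    exact ⟨i, (hc i k).2 hi⟩
  · rw [Finset.disjoint_left]
    intro i hi hi'
    exact hkl (((hc i k).1 hi).symm.trans ((hc i l).1 hi'))

theorem IsColouring.permute {n m : ℕ} {S : Fin (m + 1) → Finset (Fin n)}
    {c : Fin n → Fin (m + 1)} (hc : IsColouring S c) (σ : Equiv.Perm (Fin n)) :
    IsColouring (permute σ S) (c ∘ σ.symm) := fun i k => by
  rw [Hemimetric.permute, Finset.mem_map_equiv, hc]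
  rfl

theorem IsColouring.card_inter_le_one_iff {n m : ℕ} {S : Fin (m + 1) → Finset (Fin n)}
    {c : Fin n → Fin (m + 1)} (hc : IsColouring S c) (s : Finset (Fin n)) :
    (∀ k, (s ∩ S k).card ≤ 1) ↔ ∀ x ∈ s, ∀ y ∈ s, c x = c y → x = y := by
  simp only [Finset.card_le_one, Finset.mem_inter, hc _ _]
  exact ⟨fun h x hx y hy hxy => h _ x ⟨hx, rfl⟩ y ⟨hy, hxy.symm⟩,
    fun h k x hx y hy => h x hx.1 y hy.1 (hx.2.trans hy.2.symm)⟩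

theorem rainbow_iff : ∀ a b c d : Fin 4, rainbow a b c d = true ↔
    (a ≠ b ∧ a ≠ c ∧ a ≠ d) ∧ (b ≠ c ∧ b ≠ d) ∧ c ≠ d := by
  decide

theorem injOn_quad_iff (c : Fin 6 → Fin 4) {p q r t : Fin 6}
    (hd : (p ≠ q ∧ p ≠ r ∧ p ≠ t) ∧ (q ≠ r ∧ q ≠ t) ∧ r ≠ t) :
    (∀ x ∈ ({p, q, r, t} : Finset (Fin 6)), ∀ y ∈ ({p, q, r, t} : Finset (Fin 6)),
      c x = c y → x = y) ↔ rainbow (c p) (c q) (c r) (c t) = true := by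
  rw [rainbow_iff]
  obtain ⟨⟨h1, h2, h3⟩, ⟨h4, h5⟩, h6⟩ := hd
  simp only [Finset.mem_insert, Finset.mem_singleton, forall_eq_or_imp, forall_eq]
  simp only [h1, h2, h3, h4, h5, h6, h1.symm, h2.symm, h3.symm, h4.symm, h5.symm, h6.symm,
    imp_false, imp_true_iff, true_and, and_true]
  grind

theorem α_eq_vec {S : Fin (3 + 1) → Finset (Fin 6)} {c : Fin 6 → Fin (3 + 1)}
    (hc : IsColouring S c) : α S = vec (mask c) := by
  refine ext_quad fun i => ?_
  rw [vec_quad, α_apply, mask, testBit_ofDigits]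
  congr 1
  rw [hc.card_inter_le_one_iff]
  apply propext
  fin_cases i <;> exact injOn_quad_iff c (by decide)

theorem mask_mem_table_of_surjective {c : Fin 6 → Fin 4} (hc : Function.Surjective c) :
    mask c ∈ table.map Prod.fst := by
  have key : ∀ a b c d e f : Fin 4, (∀ k, k = a ∨ k = b ∨ k = c ∨ k = d ∨ k = e ∨ k = f) →
      (2 ^ (a : ℕ) ||| 2 ^ (b : ℕ) ||| 2 ^ (c : ℕ) ||| 2 ^ (d : ℕ) ||| 2 ^ (e : ℕ) |||
      2 ^ (f : ℕ) : ℕ) = 15 := by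
    decide +kernel
  refine mask_mem_table _ _ _ _ _ _ (key _ _ _ _ _ _ fun k => ?_)
  obtain ⟨i, rfl⟩ := hc k
  fin_cases i <;> simp

/-! ### The action of point permutations. -/

section Permutation

variable {n m : ℕ}

/-- The permutation of the `(m + 1)`-subsets induced by a permutation of the points. -/
def subsetPerm (m : ℕ) (σ : Equiv.Perm (Fin n)) :
    {s : Finset (Fin n) // s.card = m + 1} ≃ {s : Finset (Fin n) // s.card = m + 1} :=
  σ.finsetCongr.subtypeEquiv fun s => by simp

/-- The isometry induced by a permutation of the points. -/
noncomputable def permIso (m : ℕ) (σ : Equiv.Perm (Fin n)) : Space n m ≃ₗᵢ[ℝ] Space n m :=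
  LinearIsometryEquiv.piLpCongrLeft 2 ℝ ℝ (subsetPerm m σ)

theorem permIso_α (σ : Equiv.Perm (Fin n)) (S : Fin (m + 1) → Finset (Fin n)) :
    permIso m σ (α S) = α (permute σ S) := by
  ext s
  obtain ⟨s, rfl⟩ := (subsetPerm m σ).surjective s
  have h1 : permIso m σ (α S) (subsetPerm m σ s) = α S s := by
    change α S ((subsetPerm m σ).symm (subsetPerm m σ s)) = α S s
    rw [Equiv.symm_apply_apply]
  have h2 : (subsetPerm m σ s).1 = s.1.map σ.toEmbedding := rfl
  rw [h1, α_apply, α_apply]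
  simp only [h2, permute, ← Finset.map_inter, Finset.card_map]

theorem IsPartition.permute {S : Fin (m + 1) → Finset (Fin n)} (hS : IsPartition S)
    (σ : Equiv.Perm (Fin n)) : IsPartition (permute σ S) := by
  obtain ⟨c, hc, hs⟩ := hS.exists_isColouring
  exact (hc.permute σ).isPartition (hs.comp σ.symm.surjective)

theorem isSymmetry_permIso (σ : Equiv.Perm (Fin n)) :
    IsSymmetry (partitionCone n m) (permIso m σ) := by
  unfold IsSymmetry partitionCone
  rw [image_hull]
  congr 2
  ext x
  constructor
  · rintro ⟨_, ⟨S, hS, rfl⟩, rfl⟩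
    exact ⟨permute σ S, hS.permute σ, permIso_α σ S⟩
  · rintro ⟨S, hS, rfl⟩
    refine ⟨_, ⟨permute σ.symm S, hS.permute _, rfl⟩, ?_⟩
    rw [permIso_α]
    congr 1
    funext k
    simp [permute, Finset.map_map]

end Permutation

/-! ### The `65` partition vectors -/

/-- A row of the table of masks. -/
def row (i : Fin 65) : ℕ × ℕ := table.get i

theorem row_mem (i : Fin 65) : row i ∈ table := List.get_mem table i

theorem exists_row {a : ℕ × ℕ} (ha : a ∈ table) : ∃ i, row i = a :=
  List.mem_iff_get.1 ha

theorem row_injective : Function.Injective row := by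
  have : table.Nodup := by decide +kernel
  exact List.nodup_iff_injective_get.1 this

/-- The partition vectors, numbered. -/
noncomputable def gen (i : Fin 65) : Space 6 3 := vec (row i).1

theorem inner_gen (a : ℕ) (i : Fin 65) :
    inner ℝ (vec a) (gen i) = (popCount (a &&& (row i).1) : ℝ) := inner_vec _ _

theorem full_and_row (i : Fin 65) : 32767 &&& (row i).1 = (row i).1 := by
  have : ∀ a ∈ table, 32767 &&& a.1 = a.1 := by decide +kernel
  exact this _ (row_mem i)

/-- `32767 = 2 ^ 15 - 1` is the mask of all edges, so the functional is minus the number of edges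
outside the `i`-th set. -/
theorem isExposedFamily_gen : IsExposedFamily gen := fun i => by
  refine ⟨vec (row i).1 - vec 32767, fun j => ?_⟩
  obtain ⟨h1, h2⟩ := table_antichain _ (row_mem i) _ (row_mem j)
  rw [inner_sub_left, inner_gen, inner_gen, full_and_row, sub_nonpos, sub_eq_zero, Nat.cast_le,
    Nat.cast_inj]
  exact ⟨h1, h2.trans row_injective.eq_iff⟩

/-- The partition `(1, 2, 3, 456)`. -/
def trianglePartition : Fin 4 → Finset (Fin 6) := ![{0}, {1}, {2}, {3, 4, 5}]

def triangleColouring : Fin 6 → Fin 4 := ![0, 1, 2, 3, 3, 3]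

def baseColouring : Fin 6 → Fin 4 := ![0, 0, 1, 1, 2, 3]

instance {n m : ℕ} (S : Fin (m + 1) → Finset (Fin n)) (c : Fin n → Fin (m + 1)) :
    Decidable (IsColouring S c) := inferInstanceAs (Decidable (∀ i k, i ∈ S k ↔ c i = k))

theorem isColouring_triangle : IsColouring trianglePartition triangleColouring := by decide

theorem isColouring_base : IsColouring basePartition baseColouring := by decide

/-- The map of points that pulls `(1, 2, 3, 456)` or `(12, 34, 5, 6)` back to the `i`-th
partition. -/
def pullMap (i : Fin 65) : Fin 6 → Fin 6 := digitMap (codes.getD i 0)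

theorem pullMap_spec : ∀ i : Fin 65, Function.Injective (pullMap i) ∧
    (row i).1 = mask ((if i < 20 then triangleColouring else baseColouring) ∘ pullMap i) := by
  decide +kernel

/-- The inverse of `pullMap`. -/
noncomputable def pushPerm (i : Fin 65) : Equiv.Perm (Fin 6) :=
  (Equiv.ofBijective (pullMap i) (Finite.injective_iff_bijective.1 (pullMap_spec i).1)).symm

/-- `permute σ S` is coloured by `c ∘ σ.symm`, and `pullMap i` is the inverse of `pushPerm i`. -/
theorem vec_mask_comp {S : Fin (3 + 1) → Finset (Fin 6)} {c : Fin 6 → Fin (3 + 1)}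
    (hc : IsColouring S c) (i : Fin 65) :
    vec (mask (c ∘ pullMap i)) = α (permute (pushPerm i) S) :=
  (α_eq_vec (hc.permute (pushPerm i))).symm

theorem gen_of_lt {i : Fin 65} (hi : i < 20) :
    gen i = α (permute (pushPerm i) trianglePartition) := by
  rw [← vec_mask_comp isColouring_triangle, gen, (pullMap_spec i).2, if_pos hi]

theorem gen_of_le {i : Fin 65} (hi : 20 ≤ i) :
    gen i = α (permute (pushPerm i) basePartition) := by
  rw [← vec_mask_comp isColouring_base, gen, (pullMap_spec i).2, if_neg hi.not_gt]

theorem partitionVectors_eq : partitionVectors 6 3 = Set.range gen := by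
  ext x
  constructor
  · rintro ⟨S, hS, rfl⟩
    obtain ⟨c, hc, hs⟩ := hS.exists_isColouring
    obtain ⟨a, ha, hac⟩ := List.mem_map.1 (mask_mem_table_of_surjective hs)
    obtain ⟨i, rfl⟩ := exists_row ha
    exact ⟨i, by rw [α_eq_vec hc, ← hac]; rfl⟩
  · rintro ⟨i, rfl⟩
    rcases lt_or_ge i 20 with hi | hi
    · exact ⟨_, (isColouring_triangle.isPartition (by decide)).permute _, gen_of_lt hi⟩
    · exact ⟨_, (isColouring_base.isPartition (by decide)).permute _, gen_of_le hi⟩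

theorem partitionCone_eq : partitionCone 6 3 = PointedCone.hull ℝ (Set.range gen) := by
  rw [partitionCone, partitionVectors_eq]

theorem gen_injective : Function.Injective gen := fun _ _ hij =>
  isExposedFamily_gen.ray_injective (congrArg ray hij)

theorem extremeRays_eq_range :
    extremeRays (partitionCone 6 3) = Set.range fun i => ray (gen i) := by
  rw [partitionCone_eq, isExposedFamily_gen.extremeRays_eq]

/-! ### Dimension -/

/-- Take two triangles with exactly the `i`-th edge in common; the other four edges form a 4-cycle.
-/
theorem exists_xor_table : ∀ i : Fin 15, ∃ a ∈ table, ∃ b ∈ table, a.1 &&& b.1 = 2 ^ (i : ℕ) ∧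
    ∃ c ∈ table, c.1 = a.1 ^^^ b.1 := by
  decide +kernel

theorem vec_two_pow (i : Fin 15) :
    vec (2 ^ (i : ℕ)) = EuclideanSpace.single (quad i) (1 : ℝ) := by
  refine ext_quad fun j => ?_
  rw [vec_quad, Nat.testBit_two_pow]
  simp [quad_bijective.1.eq_iff, Fin.ext_iff, eq_comm]

theorem span_gen : Submodule.span ℝ (Set.range gen) = ⊤ := by
  rw [eq_top_iff, ← (EuclideanSpace.basisFun _ ℝ).toBasis.span_eq, Submodule.span_le]
  rintro _ ⟨s, rfl⟩
  obtain ⟨i, rfl⟩ := quad_bijective.2 s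
  obtain ⟨a, ha, b, hb, hab, c, hc, hcab⟩ := exists_xor_table i
  have hmem : ∀ a ∈ table, vec a.1 ∈ Submodule.span ℝ (Set.range gen) := fun a ha => by
    obtain ⟨j, rfl⟩ := exists_row ha
    exact Submodule.subset_span ⟨j, rfl⟩
  have h := vec_add_vec_xor a.1 b.1
  rw [hab, ← hcab, vec_two_pow] at h
  have h2 : EuclideanSpace.single (quad i) (1 : ℝ) =
      (2⁻¹ : ℝ) • (vec a.1 + vec b.1 - vec c.1) := by
    rw [h, add_sub_cancel_right, smul_smul, inv_mul_cancel₀ two_ne_zero, one_smul]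
  rw [OrthonormalBasis.coe_toBasis, EuclideanSpace.basisFun_apply, h2]
  exact Submodule.smul_mem _ _
    (sub_mem (add_mem (hmem a ha) (hmem b hb)) (hmem c hc))

theorem dim_partitionCone : dim (partitionCone 6 3 : Set (Space 6 3)) = 15 := by
  rw [partitionCone_eq, dim_hull, span_gen, finrank_top, finrank_euclideanSpace,
    Fintype.card_finset_len]
  rfl

/-! ### Adjacency -/

theorem exists_inner_pairWeight (a b : ℕ × ℕ) :
    ∃ v : Space 6 3, ∀ c : ℕ, inner ℝ v (vec c) = -(pairWeight a b c : ℝ) := by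
  simp only [pairWeight]
  push_cast
  generalize (popCount a.1 : ℝ) = n
  generalize (popCount b.1 : ℝ) = m
  generalize (popCount (a.1 &&& b.1) : ℝ) = k
  generalize (popCount (a.1 &&& (b.2 ^^^ (b.2 &&& b.1))) : ℝ) = d
  generalize (popCount (b.1 &&& (a.2 ^^^ (a.2 &&& a.1))) : ℝ) = e
  refine ⟨-((n * m - k * k) • (vec (a.1 &&& (b.2 ^^^ (b.2 &&& b.1))) +
    vec (b.1 &&& (a.2 ^^^ (a.2 &&& a.1))) - vec (a.1 &&& b.1)) +
    (k * (e + m - k) - m * d) • vec a.1 + (k * (d + n - k) - n * e) • vec b.1), fun c => ?_⟩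
  simp only [inner_neg_left, inner_add_left, inner_sub_left, real_inner_smul_left, inner_vec]

theorem popCount_land_le (u c : ℕ) : popCount (u &&& c) ≤ popCount c := by
  rw [← Nat.cast_le (α := ℝ), popCount_eq_sum, popCount_eq_sum]
  refine Finset.sum_le_sum fun i _ => ?_
  rw [Nat.testBit_and]
  cases u.testBit i <;> cases c.testBit i <;> simp

/-- Equality of the counts is equality bit by bit. As `popCount` sees only 15 bits, `hc` is needed
to exclude higher ones. -/
theorem lor_eq_of_popCount_eq {u c : ℕ} (h : popCount (u &&& c) = popCount c)
    (hc : 32767 &&& c = c) : u ||| c = u := by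
  have hle : ∀ i ∈ (Finset.univ : Finset (Fin 15)),
      (if (u &&& c).testBit i then (1 : ℝ) else 0) ≤ if c.testBit i then 1 else 0 := fun i _ => by
    rw [Nat.testBit_and]
    cases u.testBit i <;> cases c.testBit i <;> simp
  have h' := congrArg (Nat.cast (R := ℝ)) h
  rw [popCount_eq_sum, popCount_eq_sum, Finset.sum_eq_sum_iff_of_le hle] at h'
  refine Nat.eq_of_testBit_eq fun i => ?_
  rw [Nat.testBit_or]
  by_cases hi : i < 15
  · have := h' ⟨i, hi⟩ (Finset.mem_univ _)
    rw [Nat.testBit_and] at this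
    revert this
    cases u.testBit i <;> cases c.testBit i <;> simp
  · have : c.testBit i = false := by
      rw [← hc, Nat.testBit_and, Nat.testBit_lt_two_pow, Bool.false_and]
      exact lt_of_lt_of_le (by norm_num) (Nat.pow_le_pow_right two_pos (not_lt.1 hi))
    rw [this, Bool.or_false]

theorem row_fst_inj {i j : Fin 65} (h : (row i).1 = (row j).1) : i = j :=
  gen_injective (congrArg vec h)

theorem areAdjacent_symm {R R' : Set (Space 6 3)} (h : AreAdjacent (partitionCone 6 3) R R') :
    AreAdjacent (partitionCone 6 3) R' R := by
  obtain ⟨h1, h2, h3⟩ := h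
  rw [Set.union_comm] at h2 h3
  exact ⟨h1.symm, h2, h3⟩

theorem Separated.symm {a b : ℕ × ℕ} (h : Separated a b) : Separated b a := by
  unfold Separated at *
  rwa [Nat.land_comm b.1, Nat.land_comm b.2]

theorem areAdjacent_of_lt {i j : Fin 65} (hij : i < j) (hs : ¬ Separated (row i) (row j)) :
    AreAdjacent (partitionCone 6 3) (ray (gen i)) (ray (gen j)) := by
  have spec := List.all_eq_true.1 (List.pairwise_iff_get.1 pairWeight_spec i j hij hs)
  have spec' : ∀ k, ((row i).1 ||| (row j).1) ||| (row k).1 = (row i).1 ||| (row j).1 →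
      0 ≤ pairWeight (row i) (row j) (row k).1 ∧
        (pairWeight (row i) (row j) (row k).1 = 0 ↔ k = i ∨ k = j) := fun k hk => by
    have := spec (row k) (row_mem k)
    rw [Bool.or_eq_true, Bool.not_eq_true', decide_eq_true_iff] at this
    rcases this with h | h
    · have hk' := Nat.ne_of_beq_eq_false h
      exact absurd hk hk'
    · refine ⟨h.1, h.2.trans (or_congr ⟨fun h => row_fst_inj h, ?_⟩ ⟨fun h => row_fst_inj h, ?_⟩)⟩
      · rintro rfl
        rfl
      · rintro rfl
        rfl
  set u := (row i).1 ||| (row j).1 with hu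
  obtain ⟨v₂, hv₂⟩ := exists_inner_pairWeight (row i) (row j)
  have h1 : ∀ k, inner ℝ (vec u - vec 32767) (gen k) =
      (popCount (u &&& (row k).1) : ℝ) - popCount (row k).1 := fun k => by
    rw [inner_sub_left, inner_gen, inner_gen, full_and_row]
  have h2 : ∀ k, inner ℝ (vec u - vec 32767) (gen k) = 0 → u ||| (row k).1 = u := fun k hk => by
    rw [h1, sub_eq_zero, Nat.cast_inj] at hk
    exact lor_eq_of_popCount_eq hk (full_and_row k)
  have h3 : ∀ k, u ||| (row k).1 = u → inner ℝ (vec u - vec 32767) (gen k) = 0 := fun k hk => by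
    rw [h1, sub_eq_zero, Nat.cast_inj]
    congr 1
    rw [← hk]
    refine Nat.eq_of_testBit_eq fun t => ?_
    rw [Nat.testBit_and, Nat.testBit_or]
    cases u.testBit t <;> cases (row k).1.testBit t <;> rfl
  -- The first functional counts, negatively, the edges outside the union `u`; the second is minus
  -- `pairWeight`, needed only for rows inside `u`.
  obtain ⟨v, hv, hv0⟩ := exists_inner_lex (Set.finite_range gen)
    (v₁ := vec u - vec 32767) (v₂ := v₂) (by
      rintro _ ⟨k, rfl⟩
      rw [h1, sub_nonpos, Nat.cast_le]
      exact popCount_land_le _ _) (by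
      rintro _ ⟨k, rfl⟩ hk
      rw [gen, hv₂, neg_nonpos]
      exact_mod_cast (spec' k (h2 k hk)).1)
  rw [partitionCone_eq]
  refine isExposedFamily_gen.areAdjacent_of_inner hij.ne (fun k => hv _ ⟨k, rfl⟩) fun k => ?_
  rw [hv0 _ ⟨k, rfl⟩]
  have h4 : inner ℝ v₂ (gen k) = 0 ↔ pairWeight (row i) (row j) (row k).1 = 0 := by
    rw [gen, hv₂, neg_eq_zero, Int.cast_eq_zero]
  rw [h4]
  constructor
  · rintro ⟨ha, hb⟩
    exact (spec' k (h2 k ha)).2.1 hb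
  · intro hk
    have hk' : u ||| (row k).1 = u := by
      refine Nat.eq_of_testBit_eq fun t => ?_
      rcases hk with rfl | rfl
      · rw [hu, Nat.testBit_or, Nat.testBit_or]
        cases (row k).1.testBit t <;> simp
      · rw [hu, Nat.testBit_or, Nat.testBit_or]
        cases (row k).1.testBit t <;> simp
    exact ⟨h3 k hk', (spec' k hk').2.2 hk⟩

theorem not_areAdjacent_of_separated {i j : Fin 65} (hs : Separated (row i) (row j)) :
    ¬ AreAdjacent (partitionCone 6 3) (ray (gen i)) (ray (gen j)) := by
  obtain ⟨c, hc, hcu, hci, hcj, d, hd, hdc⟩ := separated_spec _ (row_mem i) _ (row_mem j) hs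
  obtain ⟨k, rfl⟩ := exists_row hc
  obtain ⟨l, rfl⟩ := exists_row hd
  rw [partitionCone_eq]
  refine isExposedFamily_gen.not_areAdjacent_of_add_eq (k := k) (l := l)
    (fun h => hci (h ▸ rfl)) (fun h => hcj (h ▸ rfl)) ?_
  have h1 : (row k).1 &&& (row l).1 = 0 := by
    rw [hdc]
    refine Nat.eq_of_testBit_eq fun t => ?_
    have := congrArg (fun n => Nat.testBit n t) hcu
    simp only [Nat.testBit_or] at this
    rw [Nat.testBit_and, Nat.testBit_xor, Nat.testBit_or]
    revert this
    cases (row i).1.testBit t <;> cases (row j).1.testBit t <;> cases (row k).1.testBit t <;> simp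
  have h2 : (row k).1 ||| (row l).1 = (row i).1 ||| (row j).1 := by
    rw [hdc]
    refine Nat.eq_of_testBit_eq fun t => ?_
    have := congrArg (fun n => Nat.testBit n t) hcu
    simp only [Nat.testBit_or] at this
    rw [Nat.testBit_or, Nat.testBit_xor, Nat.testBit_or]
    revert this
    cases (row i).1.testBit t <;> cases (row j).1.testBit t <;> cases (row k).1.testBit t <;> simp
  rw [gen, gen, gen, gen, vec_add_vec, vec_add_vec (row k).1, h1, h2, hs.1]

theorem areAdjacent_gen_iff {i j : Fin 65} :
    AreAdjacent (partitionCone 6 3) (ray (gen i)) (ray (gen j)) ↔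
      i ≠ j ∧ ¬ Separated (row i) (row j) := by
  constructor
  · intro h
    exact ⟨fun hij => h.1 (congrArg (fun i => ray (gen i)) hij),
      fun hs => not_areAdjacent_of_separated hs h⟩
  · rintro ⟨hij, hs⟩
    rcases lt_or_gt_of_ne hij with h | h
    · exact areAdjacent_of_lt h hs
    · exact areAdjacent_symm (areAdjacent_of_lt h fun hs' => hs hs'.symm)

/-- The node of the skeleton on the `i`-th partition vector. -/
noncomputable def node (i : Fin 65) : extremeRays (partitionCone 6 3) :=
  ⟨ray (gen i), by rw [extremeRays_eq_range]; exact ⟨i, rfl⟩⟩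

theorem node_bijective : Function.Bijective node := by
  refine ⟨fun i j hij => isExposedFamily_gen.ray_injective (congrArg Subtype.val hij), ?_⟩
  rintro ⟨R, hR⟩
  have hR' := hR
  rw [extremeRays_eq_range] at hR'
  obtain ⟨i, rfl⟩ := hR'
  exact ⟨i, rfl⟩

theorem skeleton_adj_node {i j : Fin 65} :
    (skeleton (partitionCone 6 3)).Adj (node i) (node j) ↔ i ≠ j ∧ ¬ Separated (row i) (row j) :=
  areAdjacent_gen_iff

/-! ### Orbits -/

theorem orbit_of_lt {i : Fin 65} (hi : i < 20) :
    orbit (partitionCone 6 3) (ray (gen i)) = O₁ := by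
  rw [gen_of_lt hi, ← permIso_α, ← image_ray, (isSymmetry_permIso _).orbit_image]
  rfl

theorem orbit_of_le_eq_base {i : Fin 65} (hi : 20 ≤ i) :
    orbit (partitionCone 6 3) (ray (gen i)) =
      orbit (partitionCone 6 3) (ray (α basePartition)) := by
  rw [gen_of_le hi, ← permIso_α, ← image_ray, (isSymmetry_permIso _).orbit_image]

/-- `O₂` is defined by (1,2,34,56), which is row 21, whereas the permutations start from
`basePartition`, row 20. -/
theorem orbit_of_le {i : Fin 65} (hi : 20 ≤ i) :
    orbit (partitionCone 6 3) (ray (gen i)) = O₂ := by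
  have h : gen 21 = α ![{0}, {1}, {2, 3}, {4, 5}] := by
    rw [α_eq_vec (c := ![0, 1, 2, 2, 3, 3]) (by decide)]
    rfl
  rw [orbit_of_le_eq_base hi, O₂, ← h, orbit_of_le_eq_base (by decide)]

theorem triangle_spec : ∀ i : Fin 65, i < 20 → popCount (row i).1 = 3 ∧
    ∃ k : Fin 65, popCount (row k).1 = 3 ∧ popCount ((row i).1 &&& (row k).1) = 1 := by
  decide +kernel

/-- Equality would mean cosine 1/3 between the two vectors. The squared norm of row `l` is 3 or 4,
and neither 12 nor 16 is nine times a square. -/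
theorem cycle_spec : ∀ j : Fin 65, 20 ≤ j → popCount (row j).1 = 4 ∧
    ∀ l, 9 * popCount ((row j).1 &&& (row l).1) ^ 2 ≠ 4 * popCount (row l).1 := by
  decide +kernel

theorem inner_gen_gen (i j : Fin 65) :
    inner ℝ (gen i) (gen j) = (popCount ((row i).1 &&& (row j).1) : ℝ) := inner_vec _ _

theorem inner_gen_self (i : Fin 65) : inner ℝ (gen i) (gen i) = (popCount (row i).1 : ℝ) := by
  rw [inner_gen_gen, Nat.and_self]

theorem IsSymmetry.image_ray_ne {f : Space 6 3 ≃ₗᵢ[ℝ] Space 6 3}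
    (hf : IsSymmetry (partitionCone 6 3) f) {i j : Fin 65} (hi : i < 20) (hj : 20 ≤ j) :
    f '' ray (gen i) ≠ ray (gen j) := by
  intro h
  obtain ⟨hi3, k, hk3, hik⟩ := triangle_spec i hi
  obtain ⟨hj4, hjl⟩ := cycle_spec j hj
  obtain ⟨s, -, hs⟩ : ∃ s : ℝ, 0 ≤ s ∧ f (gen i) = s • gen j := by
    rw [← mem_ray_iff, ← h]
    exact ⟨_, self_mem_ray _, rfl⟩
  obtain ⟨⟨l, hl⟩⟩ : Nonempty {l // ray (gen l) = f '' ray (gen k)} := by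
    have := hf.isExtremeRay_image (node k).2
    have : f '' ray (gen k) ∈ extremeRays (partitionCone 6 3) := this
    rw [extremeRays_eq_range] at this
    obtain ⟨l, hl⟩ := this
    exact ⟨l, hl⟩
  obtain ⟨t, -, ht⟩ : ∃ t : ℝ, 0 ≤ t ∧ f (gen k) = t • gen l := by
    rw [← mem_ray_iff, hl]
    exact ⟨_, self_mem_ray _, rfl⟩
  have h1 := f.inner_map_map (gen i) (gen i)
  have h2 := f.inner_map_map (gen k) (gen k)
  have h3 := f.inner_map_map (gen i) (gen k)
  rw [hs, real_inner_smul_left, real_inner_smul_right, inner_gen_self, inner_gen_self, hi3,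
    hj4] at h1
  rw [ht, real_inner_smul_left, real_inner_smul_right, inner_gen_self, inner_gen_self, hk3] at h2
  rw [hs, ht, real_inner_smul_left, real_inner_smul_right, inner_gen_gen, inner_gen_gen, hik] at h3
  apply hjl l
  rw [← Nat.cast_inj (R := ℝ)]
  push_cast at h1 h2 h3 ⊢
  generalize (popCount ((row j).1 &&& (row l).1) : ℝ) = p at *
  generalize (popCount (row l).1 : ℝ) = n at *
  -- Eliminating the scale factors `s` and `t` leaves the squared cosine.
  have h4 : s * s * (t * t) * (p * p) = 1 := by
    linear_combination (s * (t * p) + 1) * h3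
  have h5 : s * s * 4 = 3 := by linarith
  have h6 : t * t * n = 3 := by linarith
  have h7 : 3 * (t * t) * (p * p) = 4 := by
    linear_combination 4 * h4 - (t * t) * (p * p) * h5
  linear_combination n * h7 - 3 * (p * p) * h6

theorem ray_gen_mem_O₁ {i : Fin 65} : ray (gen i) ∈ O₁ ↔ i < 20 := by
  constructor
  · intro h
    by_contra hi
    rw [← orbit_of_lt (i := 0) (by decide)] at h
    obtain ⟨f, hf, h⟩ := h
    exact hf.image_ray_ne (i := 0) (by decide) (not_lt.1 hi) h.symm
  · intro hi
    rw [← orbit_of_lt hi]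
    exact mem_orbit_self _ _

theorem ray_gen_mem_O₂ {i : Fin 65} : ray (gen i) ∈ O₂ ↔ 20 ≤ i := by
  constructor
  · intro h
    by_contra hi
    rw [← orbit_of_le (i := 20) le_rfl] at h
    obtain ⟨f, hf, h⟩ := h
    refine hf.symm.image_ray_ne (not_le.1 hi) (le_refl (20 : Fin 65)) ?_
    rw [h, image_symm_image]
  · intro hi
    rw [← orbit_of_le hi]
    exact mem_orbit_self _ _

theorem O₁_ne_O₂ : O₁ ≠ O₂ := by
  intro h
  have h1 : ray (gen 0) ∈ O₁ := ray_gen_mem_O₁.2 (by decide)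
  rw [h, ray_gen_mem_O₂] at h1
  exact absurd h1 (by decide)

theorem orbit_image_extremeRays :
    orbit (partitionCone 6 3) '' extremeRays (partitionCone 6 3) = {O₁, O₂} := by
  rw [extremeRays_eq_range, ← Set.range_comp]
  ext O
  constructor
  · rintro ⟨i, rfl⟩
    rcases lt_or_ge i 20 with hi | hi
    · exact Or.inl (orbit_of_lt hi)
    · exact Or.inr (orbit_of_le hi)
  · rintro (rfl | rfl)
    · exact ⟨0, orbit_of_lt (by decide)⟩
    · exact ⟨20, orbit_of_le le_rfl⟩

/-! ### The skeleton -/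

/-- A 4-cycle has 6 non-neighbours and a triangle 9, too few to cover the other 63 nodes. -/
theorem exists_common_neighbour : ∀ i j : Fin 65, Separated (row i) (row j) →
    ∃ k, (i ≠ k ∧ ¬ Separated (row i) (row k)) ∧ k ≠ j ∧ ¬ Separated (row k) (row j) := by
  decide +kernel

theorem ediam_skeleton : (skeleton (partitionCone 6 3)).ediam = 2 := by
  apply le_antisymm
  · refine SimpleGraph.ediam_le_of_edist_le fun R R' => ?_
    obtain ⟨i, rfl⟩ := node_bijective.2 R
    obtain ⟨j, rfl⟩ := node_bijective.2 R'
    by_cases hij : i = j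
    · rw [hij, SimpleGraph.edist_self]
      exact bot_le
    by_cases hs : Separated (row i) (row j)
    · obtain ⟨k, hik, hkj⟩ := exists_common_neighbour i j hs
      refine (SimpleGraph.edist_triangle (v := node k)).trans ?_
      rw [SimpleGraph.edist_eq_one_iff_adj.2 (skeleton_adj_node.2 hik),
        SimpleGraph.edist_eq_one_iff_adj.2 (skeleton_adj_node.2 hkj)]
      exact le_of_eq (by norm_num)
    · rw [SimpleGraph.edist_eq_one_iff_adj.2 (skeleton_adj_node.2 ⟨hij, hs⟩)]
      norm_num
  · have h : ¬ (skeleton (partitionCone 6 3)).edist (node 20) (node 21) ≤ 1 := by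
      rw [SimpleGraph.edist_le_one_iff_adj_or_eq, skeleton_adj_node, node_bijective.1.eq_iff]
      decide +kernel
    have h2 := Order.add_one_le_of_lt (not_le.1 h)
    rw [one_add_one_eq_two] at h2
    exact h2.trans SimpleGraph.edist_le_ediam

theorem nonempty_skeletonOn_iso {κ : Type*} {H : SimpleGraph κ} {O : Set (Set (Space 6 3))}
    (h : κ → Fin 65) (hinj : Function.Injective h)
    (hO : ∀ i, ray (gen i) ∈ O ↔ i ∈ Set.range h)
    (hadj : ∀ x y, H.Adj x y ↔ h x ≠ h y ∧ ¬ Separated (row (h x)) (row (h y))) :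
    Nonempty (skeletonOn (partitionCone 6 3) O ≃g H) := by
  have hmem : ∀ x, node (h x) ∈ {R : extremeRays (partitionCone 6 3) | R.1 ∈ O} := fun x =>
    (hO (h x)).2 ⟨x, rfl⟩
  let e : κ → {R : extremeRays (partitionCone 6 3) | R.1 ∈ O} := fun x => ⟨node (h x), hmem x⟩
  have he : Function.Bijective e := by
    refine ⟨fun x y hxy => hinj (node_bijective.1 (congrArg Subtype.val hxy)), ?_⟩
    rintro ⟨R, hR⟩
    obtain ⟨i, rfl⟩ := node_bijective.2 R
    obtain ⟨x, rfl⟩ := (hO i).1 hR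
    exact ⟨x, rfl⟩
  let φ : H ≃g skeletonOn (partitionCone 6 3) O :=
    { toEquiv := Equiv.ofBijective e he
      map_rel_iff' := fun {x y} => by
        rw [hadj]
        exact skeleton_adj_node }
  exact ⟨φ.symm⟩

/-- The two masks of a triangle coincide, so triangles are never `Separated`. -/
theorem nonempty_skeletonOn_O₁_iso :
    Nonempty (skeletonOn (partitionCone 6 3) O₁ ≃g (⊤ : SimpleGraph (Fin 20))) := by
  refine nonempty_skeletonOn_iso (Fin.castLE (by norm_num)) (Fin.castLE_injective _)
    (fun i => ?_) ?_
  · rw [ray_gen_mem_O₁]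
    revert i
    decide +kernel
  · simp only [SimpleGraph.top_adj]
    decide +kernel

/-- The position in the table of the `r`-th `4`-cycle whose diagonals, together with the pair of
the two other points, form the `p`-th perfect matching. -/
def cyclePosition (x : Fin 15 × Fin 3) : Fin 65 :=
  ⟨20 + 3 * x.1 + x.2, by omega⟩

/-- Edge-disjoint 4-cycles with a common diagonal take their diagonals from the same perfect
matching of the six points; each of the 15 matchings gives three 4-cycles. -/
theorem nonempty_skeletonOn_O₂_iso :
    Nonempty (skeletonOn (partitionCone 6 3) O₂ ≃g K45Minus15K3) := by
  refine nonempty_skeletonOn_iso cyclePosition ?_ (fun i => ?_) ?_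
  · decide +kernel
  · rw [ray_gen_mem_O₂]
    revert i
    decide +kernel
  · simp only [K45Minus15K3, SimpleGraph.sdiff_adj, SimpleGraph.top_adj,
      SimpleGraph.boxProd_adj, SimpleGraph.bot_adj]
    decide +kernel

/-! ### The non-edges -/

/-- Colourings of the partitions in `nonNeighbours`. -/
def nonNeighbourColourings : List (Fin 6 → Fin 4) :=
  [![0, 0, 1, 2, 3, 3], ![0, 1, 2, 2, 3, 3], ![0, 0, 1, 2, 0, 3], ![0, 0, 1, 2, 3, 0],
    ![1, 2, 0, 0, 0, 3], ![1, 2, 0, 0, 3, 0]]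

theorem exists_isColouring_of_mem {T : Fin 4 → Finset (Fin 6)} (hT : T ∈ nonNeighbours) :
    ∃ c ∈ nonNeighbourColourings, IsColouring T c := by
  rcases hT with rfl | rfl | rfl | rfl | rfl | rfl <;> decide

theorem exists_mem_of_colouring {c : Fin 6 → Fin 4} (hc : c ∈ nonNeighbourColourings) :
    ∃ T ∈ nonNeighbours, IsColouring T c := by
  simp only [nonNeighbourColourings, List.mem_cons, List.not_mem_nil, or_false] at hc
  simp only [nonNeighbours, Set.mem_insert_iff, Set.mem_singleton_iff, exists_eq_or_imp,
    exists_eq_left]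
  rcases hc with rfl | rfl | rfl | rfl | rfl | rfl <;> decide

theorem nonNeighbourColourings_spec : ∀ c ∈ nonNeighbourColourings,
    ∃ j : Fin 65, (row j).1 = mask c ∧ 20 ≠ j ∧ Separated (row 20) (row j) := by
  decide +kernel

/-- One of the two is a 4-cycle. The list contains all non-neighbours of the base, so any
permutation taking that 4-cycle to the base takes the other ray into the list. -/
theorem exists_nonNeighbourColouring : ∀ i j : Fin 65, Separated (row i) (row j) →
    (20 ≤ i ∧ ∃ c ∈ nonNeighbourColourings, mask (c ∘ pullMap i) = (row j).1) ∨
    (20 ≤ j ∧ ∃ c ∈ nonNeighbourColourings, mask (c ∘ pullMap j) = (row i).1) := by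
  decide +kernel

theorem gen_twenty : gen 20 = α basePartition := by
  rw [α_eq_vec isColouring_base]
  rfl

theorem nonNeighbours_spec {T : Fin 4 → Finset (Fin 6)} (hT : T ∈ nonNeighbours) :
    ray (α T) ≠ ray (α basePartition) ∧
      ¬ AreAdjacent (partitionCone 6 3) (ray (α basePartition)) (ray (α T)) := by
  obtain ⟨c, hc, hTc⟩ := exists_isColouring_of_mem hT
  obtain ⟨j, hj, hne, hs⟩ := nonNeighbourColourings_spec c hc
  have hgj : gen j = α T := by rw [α_eq_vec hTc, ← hj, gen]
  rw [← hgj, ← gen_twenty]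
  exact ⟨fun h => hne (isExposedFamily_gen.ray_injective h).symm, not_areAdjacent_of_separated hs⟩

theorem exists_permute_of_separated {i j : Fin 65} (hi : 20 ≤ i)
    (h : ∃ c ∈ nonNeighbourColourings, mask (c ∘ pullMap i) = (row j).1) :
    ∃ σ : Equiv.Perm (Fin 6), ∃ T ∈ nonNeighbours,
      gen i = α (permute σ basePartition) ∧ gen j = α (permute σ T) := by
  obtain ⟨c, hc, hcj⟩ := h
  obtain ⟨T, hT, hTc⟩ := exists_mem_of_colouring hc
  exact ⟨pushPerm i, T, hT, gen_of_le hi, by rw [← vec_mask_comp hTc, hcj, gen]⟩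

theorem not_skeleton_adj_iff {R R' : extremeRays (partitionCone 6 3)} (hne : R ≠ R') :
    ¬ (skeleton (partitionCone 6 3)).Adj R R' ↔
      ∃ σ : Equiv.Perm (Fin 6), ∃ T ∈ nonNeighbours,
        s(R.1, R'.1) = s(ray (α (permute σ basePartition)), ray (α (permute σ T))) := by
  constructor
  · obtain ⟨i, rfl⟩ := node_bijective.2 R
    obtain ⟨j, rfl⟩ := node_bijective.2 R'
    intro h
    rw [skeleton_adj_node, not_and, not_not] at h
    rcases exists_nonNeighbourColouring i j (h fun hij => hne (congrArg node hij)) with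
      ⟨hi, h⟩ | ⟨hj, h⟩
    · obtain ⟨σ, T, hT, h1, h2⟩ := exists_permute_of_separated hi h
      exact ⟨σ, T, hT, by rw [← h1, ← h2]; rfl⟩
    · obtain ⟨σ, T, hT, h1, h2⟩ := exists_permute_of_separated hj h
      exact ⟨σ, T, hT, by rw [← h1, ← h2, Sym2.eq_swap]; rfl⟩
  · rintro ⟨σ, T, hT, h⟩ hadj
    have hadj : AreAdjacent (partitionCone 6 3) R.1 R'.1 := hadj
    refine (nonNeighbours_spec hT).2 ?_
    rw [← (isSymmetry_permIso σ).areAdjacent_image_iff, image_ray, image_ray, permIso_α, permIso_α]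
    rcases Sym2.eq_iff.1 h with ⟨h1, h2⟩ | ⟨h1, h2⟩
    · rwa [← h1, ← h2]
    · rw [← h1, ← h2]
      exact areAdjacent_symm hadj

end Hemimetric

theorem mainTheorem3 :
    -- the cone has dimension 15; its extreme rays are generated by the 65 partition vectors
    Hemimetric.dim (Hemimetric.partitionCone 6 3 : Set (Hemimetric.Space 6 3)) = 15 ∧
    (Hemimetric.partitionVectors 6 3).ncard = 65 ∧
    Hemimetric.extremeRays (Hemimetric.partitionCone 6 3) =
      Hemimetric.ray '' Hemimetric.partitionVectors 6 3 ∧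
    (Hemimetric.extremeRays (Hemimetric.partitionCone 6 3)).ncard = 65 ∧
    -- there are two orbits of extreme rays
    Hemimetric.orbit (Hemimetric.partitionCone 6 3) ''
      Hemimetric.extremeRays (Hemimetric.partitionCone 6 3) = {Hemimetric.O₁, Hemimetric.O₂} ∧
    Hemimetric.O₁ ≠ Hemimetric.O₂ ∧
    -- the diameter of the skeleton
    (Hemimetric.skeleton (Hemimetric.partitionCone 6 3)).ediam = 2 ∧
    -- the subgraphs induced on the two orbits
    Nonempty (Hemimetric.skeletonOn (Hemimetric.partitionCone 6 3) Hemimetric.O₁ ≃g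
      (⊤ : SimpleGraph (Fin 20))) ∧
    Nonempty (Hemimetric.skeletonOn (Hemimetric.partitionCone 6 3) Hemimetric.O₂ ≃g
      Hemimetric.K45Minus15K3) ∧
    -- the listed pairs are non-edges
    (∀ T ∈ Hemimetric.nonNeighbours,
      Hemimetric.ray (Hemimetric.α T) ≠
        Hemimetric.ray (Hemimetric.α Hemimetric.basePartition) ∧
      ¬ Hemimetric.AreAdjacent (Hemimetric.partitionCone 6 3)
        (Hemimetric.ray (Hemimetric.α Hemimetric.basePartition))
        (Hemimetric.ray (Hemimetric.α T))) ∧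
    -- up to permutations of the points, they are the only non-edges
    (∀ R R' : Hemimetric.extremeRays (Hemimetric.partitionCone 6 3), R ≠ R' →
      (¬ (Hemimetric.skeleton (Hemimetric.partitionCone 6 3)).Adj R R' ↔
        ∃ σ : Equiv.Perm (Fin 6), ∃ T ∈ Hemimetric.nonNeighbours,
          s(R.1, R'.1) =
            s(Hemimetric.ray (Hemimetric.α (Hemimetric.permute σ Hemimetric.basePartition)),
              Hemimetric.ray (Hemimetric.α (Hemimetric.permute σ T))))) := by
  have hinj : Function.Injective fun i => Hemimetric.ray (Hemimetric.gen i) :=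
    Hemimetric.isExposedFamily_gen.ray_injective
  refine ⟨Hemimetric.dim_partitionCone, ?_, ?_, ?_, Hemimetric.orbit_image_extremeRays,
    Hemimetric.O₁_ne_O₂, Hemimetric.ediam_skeleton, Hemimetric.nonempty_skeletonOn_O₁_iso,
    Hemimetric.nonempty_skeletonOn_O₂_iso, fun T hT => Hemimetric.nonNeighbours_spec hT,
    fun R R' hne => Hemimetric.not_skeleton_adj_iff hne⟩
  · rw [Hemimetric.partitionVectors_eq, ← Set.image_univ,
      Set.ncard_image_of_injective _ Hemimetric.gen_injective, Set.ncard_univ, Nat.card_fin]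
  · rw [Hemimetric.extremeRays_eq_range, Hemimetric.partitionVectors_eq, ← Set.range_comp]
    rfl
  · rw [Hemimetric.extremeRays_eq_range, ← Set.image_univ,
      Set.ncard_image_of_injective _ hinj, Set.ncard_univ, Nat.card_fin]
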